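/- Let $n \ge 0$ and let $M$ be an $n\times n$ real matrix that is nonderogatory, i.e. its characteristic and minimal polynomials coincide. Let $\mathbb R[M]\subset \mathfrak{gl}(n,\mathbb R)$ be the Abelian Lie algebra of polynomials in $M$, and let $\mathcal G_M=\mathbb R[M]\ltimes\mathbb R^n$ be the real Lie algebra with underlying vector space $\mathbb R[M]\oplus\mathbb R^n$ and bracket $[a,b]=0$, $[x,y]=0$, $[a,x]=ax$ for $a,b\in\mathbb R[M]$ and $x,y\in\mathbb R^n$. For $K=\mathbb R$ or $K=\mathbb C$, let $\mathfrak{aff}(K)=\left\{\begin{pmatrix} a & b\\ 0& 0\end{pmatrix} : a,b\in K\right\}$, with the commutator bracket, viewed as a real Lie algebra. Then the following are equivalent. 1. Every derivation of $\mathcal G_M$ is inner. 2. $\mathbb R[M]$ is a Cartan subalgebra of $\mathfrak{gl}(n,\mathbb R)$, i.e. a nilpotent subalgebra that is equal to its own normalizer. 3. $M$ has $n$ distinct (real or complex) eigenvalues. 4. The nilradical of $\mathcal G_M$ (its largest nilpotent ideal) is Abelian. 5. There are integers $p,q\ge 0$ such that $\mathcal G_M$ is isomorphic, as a real Lie algebra,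 to the direct sum of $p$ copies of $\mathfrak{aff}(\mathbb R)$ and $q$ copies of $\mathfrak{aff}(\mathbb C)$. -/

import Mathlib

/- `𝔤𝔩(n, ℝ)` is the space of matrices with the commutator bracket. For commutative algebras
(`ℝ`, `ℂ`, `Fin n → ℝ`) the commutator bracket is the zero bracket. -/
attribute [local instance 100] LieRing.ofAssociativeRing

/-- A square matrix is nonderogatory (or cyclic) if its characteristic polynomial and its minimal
polynomial coincide. -/
def Matrix.IsNonderogatory {n : ℕ} (M : Matrix (Fin n) (Fin n) ℝ) : Prop :=
  M.charpoly = minpoly ℝ M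

instance isLieAbelian_of_commRing (V : Type*) [CommRing V] : IsLieAbelian V :=
  ⟨fun x y => by rw [LieRing.of_associative_ring_bracket, mul_comm, sub_self]⟩

/-- Every linear endomorphism of an Abelian Lie algebra `V` is a derivation of `V`. -/
def endToLieDerivation (V : Type*) [LieRing V] [LieAlgebra ℝ V] [IsLieAbelian V] :
    Module.End ℝ V →ₗ⁅ℝ⁆ LieDerivation ℝ V V where
  toFun f := { f with leibniz' := fun x y => by simp [trivial_lie_zero] }
  map_add' _ _ := rfl
  map_smul' _ _ := rfl
  map_lie' := rfl

/-- The natural action `a ↦ (x ↦ a x)` of a Lie subalgebra `B` of `𝔤𝔩(n, ℝ)` on `ℝⁿ`, the latter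
being viewed as an Abelian Lie algebra. -/
def matrixAction {n : ℕ} (B : LieSubalgebra ℝ (Matrix (Fin n) (Fin n) ℝ)) :
    B →ₗ⁅ℝ⁆ LieDerivation ℝ (Fin n → ℝ) (Fin n → ℝ) :=
  (endToLieDerivation (Fin n → ℝ)).comp
    ((lieEquivMatrix' (R := ℝ) (n := Fin n)).symm.toLieHom.comp B.incl)

/-- `ℝ[M]`, the algebra of polynomials in `M`, as a Lie subalgebra of `𝔤𝔩(n, ℝ)`. -/
def polyLie {n : ℕ} (M : Matrix (Fin n) (Fin n) ℝ) :
    LieSubalgebra ℝ (Matrix (Fin n) (Fin n) ℝ) :=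
  lieSubalgebraOfSubalgebra ℝ (Matrix (Fin n) (Fin n) ℝ) (Algebra.adjoin ℝ {M})

/-- The Lie algebra `𝒢_M = ℝ[M] ⋉ ℝⁿ`. -/
abbrev GLie {n : ℕ} (M : Matrix (Fin n) (Fin n) ℝ) : Type :=
  LieAlgebra.SemiDirectSum (Fin n → ℝ) (polyLie M) (matrixAction (polyLie M))

/-- Multiplication `a ↦ (x ↦ a x)` of a commutative real algebra `K` on itself, where the acting
and the acted-upon copies of `K` are Abelian Lie algebras. -/
def affAction (K : Type) [CommRing K] [Algebra ℝ K] : K →ₗ⁅ℝ⁆ LieDerivation ℝ K K :=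
  (endToLieDerivation K).comp (Algebra.lmul ℝ K).toLieHom

/-- `𝔞𝔣𝔣(K)`, the Lie algebra of the group of affine motions `x ↦ a x + b` of the line `K`, as a
real Lie algebra: pairs `(x, a)` with `[(x, a), (y, b)] = (a y - b x, 0)`. It is used for `K = ℝ`
and `K = ℂ`. -/
abbrev Aff (K : Type) [CommRing K] [Algebra ℝ K] : Type :=
  LieAlgebra.SemiDirectSum K K (affAction K)

/-- The nilradical of a Lie algebra: the sum of all ideals that are nilpotent as Lie algebras (for
a finite-dimensional Lie algebra, this is its largest nilpotent ideal). Mathlib's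
`LieAlgebra.maxNilpotentIdeal` is a different ideal: there the whole Lie algebra has to act
nilpotently on the ideal. -/
def lieNilradical (L : Type*) [LieRing L] [LieAlgebra ℝ L] : LieIdeal ℝ L :=
  sSup {I : LieIdeal ℝ L | LieRing.IsNilpotent I}

/-- The bracket of `𝒢_M`: `[a + x, b + y] = a y - b x`. -/
theorem GLie_lie {n : ℕ} (M : Matrix (Fin n) (Fin n) ℝ) (u v : GLie M) :
    ⁅u, v⁆ = ⟨(u.right : Matrix (Fin n) (Fin n) ℝ).mulVec v.left
      - (v.right : Matrix (Fin n) (Fin n) ℝ).mulVec u.left, 0⟩ := by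
  have h : ⁅u.right, v.right⁆ = 0 := by
    apply Subtype.ext
    have hu : (u.right : Matrix (Fin n) (Fin n) ℝ) ∈ Algebra.adjoin ℝ {M} := u.right.2
    have hv : (v.right : Matrix (Fin n) (Fin n) ℝ) ∈ Algebra.adjoin ℝ {M} := v.right.2
    have hc := Algebra.commute_of_mem_adjoin_singleton_of_commute hv
      (Algebra.commute_of_mem_adjoin_self hu).symm
    rw [LieSubalgebra.coe_bracket, LieRing.of_associative_ring_bracket, hc.eq, sub_self]
    rfl
  rw [LieAlgebra.SemiDirectSum.lie_eq_mk, h, trivial_lie_zero, zero_add]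
  rfl

/-- The bracket of `𝔞𝔣𝔣(K)`. -/
theorem Aff_lie (K : Type) [CommRing K] [Algebra ℝ K] (u v : Aff K) :
    ⁅u, v⁆ = ⟨u.right * v.left - v.right * u.left, 0⟩ := by
  rw [LieAlgebra.SemiDirectSum.lie_eq_mk, trivial_lie_zero, trivial_lie_zero, zero_add]
  rfl

/-! Everything is compared with separability of the minimal polynomial m of M. A cyclic vector
identifies both ℝ[M] and ℝⁿ with ℝ[X]/(m), the action becoming multiplication.

If m is separable, ℝ[X]/(m) is a product of copies of ℝ and ℂ, which splits 𝒢_M into affine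
algebras. It is reduced, so nilpotent ideals lie in ℝⁿ. A matrix B with [B, M] ∈ ℝ[M] satisfies
m'(M)[B, M] = 0, hence commutes with M; this makes derivations inner.

If m is not separable, some nonzero a ∈ ℝ[M] has a² = 0. Then ℝa + ℝⁿ is a non-Abelian nilpotent
ideal, and a violates `SqZeroCentralizesDerived`, which sums of affine algebras satisfy. A nonzero
derivation of ℝ[X]/(m) gives a matrix normalizing ℝ[M] from outside, so ℝ[M] is not Cartan. Finally,
inner derivations force ℝ[M] to be Cartan, since its normalizer acts on 𝒢_M by derivations. -/

open Polynomial in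
/-- A nonderogatory matrix has a cyclic vector. -/
theorem Matrix.IsNonderogatory.exists_cyclic {n : ℕ} {M : Matrix (Fin n) (Fin n) ℝ}
    (hM : M.IsNonderogatory) :
    ∃ v : Fin n → ℝ, (∀ p : ℝ[X], (aeval M p).mulVec v = 0 → aeval M p = 0) ∧
      ∀ x : Fin n → ℝ, ∃ p : ℝ[X], (aeval M p).mulVec v = x := by
  have hact (p : ℝ[X]) (x : Fin n → ℝ) : aeval (Matrix.toLin' M) p x = (aeval M p).mulVec x := by
    have h := Polynomial.aeval_algHom_apply (Matrix.toLinAlgEquiv' (R := ℝ) (n := Fin n)) M p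
    exact congrArg (fun f : Module.End ℝ (Fin n → ℝ) => f x) h
  -- Over the principal ideal domain ℝ[X], some vector has the same annihilator as the whole module.
  obtain ⟨w, hw⟩ := Module.exists_ker_toSpanSingleton_eq_annihilator ℝ[X]
    (Module.AEval' (Matrix.toLin' M))
  obtain ⟨v, rfl⟩ := (Module.AEval'.of (Matrix.toLin' M)).surjective w
  have hker (p : ℝ[X]) (hp : (aeval M p).mulVec v = 0) : aeval M p = 0 := by
    have h1 : p ∈ Module.annihilator ℝ[X] (Module.AEval' (Matrix.toLin' M)) := by
      rw [← hw, LinearMap.mem_ker, LinearMap.toSpanSingleton_apply, ← Module.AEval.of_aeval_smul]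
      change Module.AEval'.of _ (aeval (Matrix.toLin' M) p v) = 0
      rw [hact, hp, map_zero]
    rw [Module.mem_annihilator] at h1
    apply Matrix.toLin'.injective
    ext1 i
    ext1
    have h2 := h1 (Module.AEval'.of _ (Pi.single i 1))
    rw [← Module.AEval.of_aeval_smul] at h2
    replace h2 := (Module.AEval'.of _).map_eq_zero_iff.1 h2
    change aeval (Matrix.toLin' M) p _ = 0 at h2
    rw [hact] at h2
    simpa using h2
  refine ⟨v, hker, ?_⟩
  -- Since m has degree n, evaluation at v is injective on polynomials of degree < n, hence
  -- surjective by dimension.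
  let F : degreeLT ℝ n →ₗ[ℝ] (Fin n → ℝ) :=
    ((Matrix.mulVecBilin ℝ ℝ).flip v).comp ((aeval M).toLinearMap.comp (degreeLT ℝ n).subtype)
  have hF : Function.Injective F := by
    rw [injective_iff_map_eq_zero]
    rintro ⟨p, hp⟩ h
    have h0 : aeval M p = 0 := hker p h
    rw [mem_degreeLT] at hp
    apply Subtype.ext
    refine Polynomial.eq_zero_of_dvd_of_degree_lt (minpoly.dvd ℝ M h0) ?_
    rw [← hM, Matrix.charpoly_degree_eq_dim, Fintype.card_fin]
    exact hp
  have : Module.Finite ℝ (degreeLT ℝ n) := (degreeLTEquiv ℝ n).symm.finiteDimensional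
  have hs : Function.Surjective F :=
    (LinearMap.injective_iff_surjective_of_finrank_eq_finrank
      (LinearEquiv.finrank_eq (degreeLTEquiv ℝ n))).1 hF
  intro x
  obtain ⟨p, hp⟩ := hs x
  exact ⟨p, hp⟩

/-! ### Polynomials in M, commutants and separability -/

section

open Polynomial

variable {n : ℕ} {M : Matrix (Fin n) (Fin n) ℝ}

theorem mem_polyLie {a : Matrix (Fin n) (Fin n) ℝ} :
    a ∈ polyLie M ↔ ∃ p : ℝ[X], aeval M p = a := by
  change a ∈ Algebra.adjoin ℝ {M} ↔ _
  rw [Algebra.adjoin_singleton_eq_range_aeval]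
  rfl

theorem aeval_mem_polyLie (p : ℝ[X]) : aeval M p ∈ polyLie M := mem_polyLie.2 ⟨p, rfl⟩

/-- Matrices commuting with a nonderogatory matrix `M` are polynomials in `M`. -/
theorem Matrix.IsNonderogatory.mem_polyLie_of_commute (hM : M.IsNonderogatory)
    {B : Matrix (Fin n) (Fin n) ℝ} (hB : B * M = M * B) : B ∈ polyLie M := by
  obtain ⟨v, -, hv⟩ := hM.exists_cyclic
  -- B and p(M) both commute with ℝ[M] and agree on the generator v, so they are equal.
  obtain ⟨p, hp⟩ := hv (B.mulVec v)
  have hc (q : ℝ[X]) : B * aeval M q = aeval M q * B :=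
    Algebra.commute_of_mem_adjoin_singleton_of_commute
      (Algebra.adjoin_singleton_eq_range_aeval ℝ M ▸ AlgHom.mem_range_self (aeval M) q) hB
  refine mem_polyLie.2 ⟨p, ?_⟩
  apply Matrix.mulVec_injective
  funext x
  obtain ⟨q, rfl⟩ := hv x
  rw [Matrix.mulVec_mulVec, Matrix.mulVec_mulVec, hc q, ← Matrix.mulVec_mulVec _ _ B, ← hp,
    Matrix.mulVec_mulVec, ← map_mul, ← map_mul, mul_comm]

theorem eq_zero_of_pow_eq_zero_of_separable (hs : (minpoly ℝ M).Separable)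
    {a : Matrix (Fin n) (Fin n) ℝ} (ha : a ∈ polyLie M) {k : ℕ} (h : a ^ k = 0) : a = 0 := by
  obtain ⟨p, rfl⟩ := mem_polyLie.1 ha
  rw [← map_pow] at h
  have := minpoly.dvd ℝ M h
  rcases Nat.eq_zero_or_pos k with rfl | hk
  · have h1 : (1 : Matrix (Fin n) (Fin n) ℝ) = 0 := by simpa using h
    rw [← mul_one (aeval M p), h1, mul_zero]
  · rw [hs.squarefree.dvd_pow_iff_dvd hk.ne'] at this
    obtain ⟨q, rfl⟩ := this
    simp

/-- If m = x²y with x not a unit, take a = (xy)(M). -/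
theorem exists_mul_self_eq_zero_of_not_separable (hs : ¬ (minpoly ℝ M).Separable) :
    ∃ a ∈ polyLie M, a ≠ 0 ∧ a * a = 0 := by
  have h0 : minpoly ℝ M ≠ 0 := minpoly.ne_zero (Algebra.IsIntegral.isIntegral M)
  rw [PerfectField.separable_iff_squarefree, Squarefree] at hs
  push Not at hs
  obtain ⟨x, ⟨y, hy⟩, hx⟩ := hs
  refine ⟨aeval M (x * y), aeval_mem_polyLie _, fun h => hx ?_, ?_⟩
  · obtain ⟨z, hz⟩ := minpoly.dvd ℝ M h
    rw [hy] at h0 hz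
    have hxy : x * y ≠ 0 := fun h => h0 (by rw [mul_assoc, h, mul_zero])
    refine IsUnit.of_mul_eq_one z (mul_left_cancel₀ hxy ?_)
    linear_combination -hz
  · rw [← map_mul, show x * y * (x * y) = minpoly ℝ M * y by rw [hy]; ring, map_mul, minpoly.aeval,
      zero_mul]

/-- With e = m / gcd(m, m'), m divides m'e, so p ↦ p'e descends to a derivation of ℝ[X]/(m). Carried
to ℝⁿ by the cyclic vector, it becomes a matrix B with [B, p(M)] = (p'e)(M); in particular [B, M] =
e(M) ≠ 0. -/
theorem exists_normalizing_of_not_separable (hM : M.IsNonderogatory)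
    (hs : ¬ (minpoly ℝ M).Separable) :
    ∃ B ∈ (polyLie M).normalizer, B ∉ polyLie M := by
  have h0 : minpoly ℝ M ≠ 0 := minpoly.ne_zero (Algebra.IsIntegral.isIntegral M)
  obtain ⟨v, hv, hsurj⟩ := hM.exists_cyclic
  obtain ⟨e, he0, he⟩ : ∃ e : ℝ[X], aeval M e ≠ 0 ∧ aeval M (derivative (minpoly ℝ M) * e) = 0 := by
    set m := minpoly ℝ M with hm
    obtain ⟨h, hh⟩ := EuclideanDomain.gcd_dvd_left m (derivative m)
    obtain ⟨k, hk⟩ := EuclideanDomain.gcd_dvd_right m (derivative m)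
    rw [Polynomial.Separable, ← EuclideanDomain.gcd_isUnit_iff] at hs
    set g := EuclideanDomain.gcd m (derivative m)
    refine ⟨h, fun hz => hs ?_, ?_⟩
    · obtain ⟨z, hz⟩ := minpoly.dvd ℝ M hz
      rw [← hm] at hz
      have hne : h ≠ 0 := fun h' => h0 (by rw [hh, h', mul_zero])
      refine IsUnit.of_mul_eq_one z (mul_left_cancel₀ hne ?_)
      linear_combination -hz - z * hh
    · rw [hk, show g * k * h = m * k by rw [mul_right_comm, ← hh], map_mul, hm, minpoly.aeval,
        zero_mul]
  let ev : Matrix (Fin n) (Fin n) ℝ →ₗ[ℝ] (Fin n → ℝ) := (Matrix.mulVecBilin ℝ ℝ).flip v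
  let F : ℝ[X] →ₗ[ℝ] (Fin n → ℝ) := ev.comp (aeval M).toLinearMap
  let G : ℝ[X] →ₗ[ℝ] (Fin n → ℝ) :=
    ev.comp ((aeval M).toLinearMap.comp ((LinearMap.mulRight ℝ e).comp derivative))
  have hF (p : ℝ[X]) : F p = (aeval M p).mulVec v := rfl
  have hG (p : ℝ[X]) : G p = (aeval M (derivative p * e)).mulVec v := rfl
  have hFG (p : ℝ[X]) (hp : F p = 0) : G p = 0 := by
    obtain ⟨q, rfl⟩ := minpoly.dvd ℝ M (hv p hp)
    rw [hG, show derivative (minpoly ℝ M * q) * e =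
      derivative (minpoly ℝ M) * e * q + minpoly ℝ M * (derivative q * e) by
        rw [derivative_mul]; ring, map_add, map_mul, he, map_mul, minpoly.aeval]
    simp
  -- By `hFG`, G factors through F; a linear section of F realizes the factorization.
  obtain ⟨s, hsec⟩ := F.exists_rightInverse_of_surjective (LinearMap.range_eq_top.2 hsurj)
  let B := LinearMap.toMatrix' (G.comp s)
  have hB (p : ℝ[X]) : B.mulVec ((aeval M p).mulVec v) = (aeval M (derivative p * e)).mulVec v := by
    rw [← Matrix.toLin'_apply, Matrix.toLin'_toMatrix', ← hF, ← hG, LinearMap.comp_apply,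
      ← sub_eq_zero, ← map_sub]
    apply hFG
    rw [map_sub, ← LinearMap.comp_apply F s, hsec, LinearMap.id_apply, sub_self]
  have hlie (p : ℝ[X]) : B * aeval M p - aeval M p * B = aeval M (derivative p * e) := by
    apply Matrix.mulVec_injective
    funext x
    obtain ⟨q, rfl⟩ := hsurj x
    have hm (f g : ℝ[X]) : (aeval M f).mulVec ((aeval M g).mulVec v) = (aeval M (f * g)).mulVec v := by
      rw [Matrix.mulVec_mulVec, map_mul]
    rw [Matrix.sub_mulVec, ← Matrix.mulVec_mulVec, ← Matrix.mulVec_mulVec, hB, hm, hm, hm, hB,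
      ← Matrix.sub_mulVec, ← map_sub, derivative_mul]
    congr 2
    ring
  refine ⟨B, ?_, fun h => he0 ?_⟩
  · rw [LieSubalgebra.mem_normalizer_iff]
    intro y hy
    obtain ⟨p, rfl⟩ := mem_polyLie.1 hy
    rw [LieRing.of_associative_ring_bracket, hlie]
    exact aeval_mem_polyLie _
  · obtain ⟨q, hq⟩ := mem_polyLie.1 h
    have := hlie X
    rw [← hq, ← map_mul, ← map_mul, mul_comm, sub_self] at this
    simpa using this.symm

/-- The chain rule for the derivation [B, ·], valid because [B, M] commutes with M. -/
theorem mul_aeval_sub_aeval_mul {R A : Type*} [CommRing R] [Ring A] [Algebra R A] (M B : A)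
    (hc : M * (B * M - M * B) = (B * M - M * B) * M) (p : R[X]) :
    B * aeval M p - aeval M p * B = aeval M (derivative p) * (B * M - M * B) := by
  induction p using Polynomial.induction_on' with
  | add p q hp hq =>
    rw [derivative_add, map_add, map_add, add_mul _ _ (B * M - M * B), ← hp, ← hq]
    noncomm_ring
  | monomial k r =>
    rw [← C_mul_X_pow_eq_monomial, derivative_C_mul, map_mul, map_mul, aeval_C, mul_assoc, mul_assoc,
      ← mul_assoc B, ← Algebra.commutes, mul_assoc, ← mul_sub]
    congr 1
    have hck (j : ℕ) : M ^ j * (B * M - M * B) = (B * M - M * B) * M ^ j :=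
      ((Commute.pow_left (show Commute M _ from hc) j)).eq
    induction k with
    | zero => simp
    | succ k ih =>
      have h1 : B * M ^ (k + 1) - M ^ (k + 1) * B =
          (B * M ^ k - M ^ k * B) * M + M ^ k * (B * M - M * B) := by
        rw [pow_succ]; noncomm_ring
      simp only [map_pow, aeval_X] at ih ⊢
      rw [h1, ih, mul_assoc, ← hc, ← mul_assoc, ← add_mul]
      congr 1
      simp only [derivative_X_pow, map_mul, aeval_X, map_pow, map_natCast]
      rcases k with _ | k
      · simp
      · rw [Nat.add_sub_cancel, Nat.add_sub_cancel, mul_assoc, ← pow_succ]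
        push_cast
        noncomm_ring

/-- The chain rule at p = m gives m'(M)[B, M] = 0, and m'(M) is invertible by the Bézout identity
for m and m'. -/
theorem commute_of_separable (hs : (minpoly ℝ M).Separable) {B : Matrix (Fin n) (Fin n) ℝ}
    (hc : M * (B * M - M * B) = (B * M - M * B) * M) : B * M = M * B := by
  obtain ⟨u, w, huw⟩ := hs
  have h := mul_aeval_sub_aeval_mul M B hc (minpoly ℝ M)
  rw [minpoly.aeval, mul_zero, zero_mul, sub_zero] at h
  have h1 := congrArg (aeval M) huw
  rw [map_add, map_mul, map_mul, minpoly.aeval, mul_zero, zero_add, map_one] at h1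
  rw [← sub_eq_zero, ← one_mul (B * M - M * B), ← h1, mul_assoc, ← h, mul_zero]

theorem ncard_eigenvalues_eq_iff (hM : M.IsNonderogatory) :
    {z : ℂ | Module.End.HasEigenvalue
      (Matrix.toLin' (M.map (algebraMap ℝ ℂ))) z}.ncard = n ↔ (minpoly ℝ M).Separable := by
  have h0 : minpoly ℝ M ≠ 0 := minpoly.ne_zero (Algebra.IsIntegral.isIntegral M)
  have hset : {z : ℂ | Module.End.HasEigenvalue (Matrix.toLin' (M.map (algebraMap ℝ ℂ))) z} =
      (minpoly ℝ M).rootSet ℂ := by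
    ext z
    rw [Set.mem_ofPred_eq, Module.End.hasEigenvalue_iff_isRoot_charpoly, Matrix.charpoly_toLin',
      Matrix.charpoly_map, hM, mem_rootSet_of_ne h0, IsRoot, eval_map_algebraMap]
  have hd : (minpoly ℝ M).natDegree = n := by
    rw [← hM, Matrix.charpoly_natDegree_eq_dim, Fintype.card_fin]
  rw [hset, ← Nat.card_coe_set_eq, Nat.card_eq_fintype_card,
    ← card_rootSet_eq_natDegree_iff_of_splits (K := ℂ) h0 (IsAlgClosed.splits _), hd]

end

/-! ### Derivations and the nilradical of 𝒢_M -/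

section

open Polynomial

variable {n : ℕ} {M : Matrix (Fin n) (Fin n) ℝ}

theorem one_mem_polyLie : (1 : Matrix (Fin n) (Fin n) ℝ) ∈ polyLie M := by
  simpa using aeval_mem_polyLie (M := M) 1

theorem polyLie_mul_comm {a b : Matrix (Fin n) (Fin n) ℝ} (ha : a ∈ polyLie M)
    (hb : b ∈ polyLie M) : a * b = b * a := by
  obtain ⟨p, rfl⟩ := mem_polyLie.1 ha
  obtain ⟨q, rfl⟩ := mem_polyLie.1 hb
  rw [← map_mul, ← map_mul, mul_comm]

theorem polyLie_lie_eq_zero (a b : polyLie M) : ⁅a, b⁆ = 0 := by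
  apply Subtype.ext
  rw [LieSubalgebra.coe_bracket, LieRing.of_associative_ring_bracket, polyLie_mul_comm a.2 b.2,
    sub_self]
  rfl

theorem GLie_ext {u w : GLie M} (hl : u.left = w.left)
    (hr : (u.right : Matrix (Fin n) (Fin n) ℝ) = w.right) : u = w :=
  LieAlgebra.SemiDirectSum.ext hl (Subtype.ext hr)

theorem GLie_lie_left (u w : GLie M) :
    ⁅u, w⁆.left = (u.right : Matrix (Fin n) (Fin n) ℝ).mulVec w.left
      - (w.right : Matrix (Fin n) (Fin n) ℝ).mulVec u.left := by
  rw [GLie_lie]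

theorem GLie_lie_right (u w : GLie M) : ⁅u, w⁆.right = 0 := by
  rw [GLie_lie]

instance : Module.Finite ℝ (GLie M) :=
  Module.Finite.equiv (LieAlgebra.SemiDirectSum.toProdl (matrixAction (polyLie M))).symm

/-- An element of the normalizer of `ℝ[M]` induces a derivation of `𝒢_M`. -/
def derivationOfNormalizer (B : Matrix (Fin n) (Fin n) ℝ) (hB : B ∈ (polyLie M).normalizer) :
    LieDerivation ℝ (GLie M) (GLie M) where
  toFun u := ⟨B.mulVec u.left, ⟨⁅B, (u.right : Matrix (Fin n) (Fin n) ℝ)⁆,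
    (LieSubalgebra.mem_normalizer_iff _ B).1 hB _ u.right.2⟩⟩
  map_add' u w := by
    apply GLie_ext
    · exact Matrix.mulVec_add B u.left w.left
    · exact lie_add B (u.right : Matrix (Fin n) (Fin n) ℝ) w.right
  map_smul' t u := by
    apply GLie_ext
    · exact Matrix.mulVec_smul B t u.left
    · exact lie_smul t B (u.right : Matrix (Fin n) (Fin n) ℝ)
  leibniz' u w := by
    simp only [LinearMap.coe_mk, AddHom.coe_mk, GLie_lie]
    apply GLie_ext
    · simp only [LieRing.of_associative_ring_bracket, LieAlgebra.SemiDirectSum.sub_eq_mk,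
        Matrix.sub_mulVec, Matrix.mulVec_sub, Matrix.mulVec_mulVec]
      abel
    · simp

theorem polyLie_isCartanSubalgebra_of_forall_inner (hM : M.IsNonderogatory)
    (h : ∀ D : LieDerivation ℝ (GLie M) (GLie M), ∃ x : GLie M, ∀ y : GLie M, D y = ⁅x, y⁆) :
    (polyLie M).IsCartanSubalgebra := by
  refine ⟨?_, le_antisymm (fun B hB => ?_) (polyLie M).le_normalizer⟩
  · have : IsLieAbelian (polyLie M) := ⟨polyLie_lie_eq_zero⟩
    infer_instance
  · obtain ⟨x, hx⟩ := h (derivationOfNormalizer B hB)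
    have hMm : M ∈ polyLie M := by simpa using aeval_mem_polyLie (M := M) X
    have h1 := congrArg (fun u : GLie M => (u.right : Matrix (Fin n) (Fin n) ℝ)) (hx ⟨0, M, hMm⟩)
    simp only [GLie_lie_right] at h1
    exact hM.mem_polyLie_of_commute (sub_eq_zero.1 h1)

theorem separable_of_polyLie_isCartanSubalgebra (hM : M.IsNonderogatory)
    (h : (polyLie M).IsCartanSubalgebra) : (minpoly ℝ M).Separable := by
  by_contra hs
  obtain ⟨B, hB, hB'⟩ := exists_normalizing_of_not_separable hM hs
  rw [h.self_normalizing] at hB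
  exact hB' hB

/-- Since x = [1, x], D preserves ℝⁿ and acts there by a matrix B. Leibniz on [a, x] shows that D
acts on ℝ[M] modulo ℝⁿ as [B, ·], so [B, M] ∈ ℝ[M] and separability puts B in ℝ[M]. From [1, a] = 0,
the ℝⁿ-part of D a is a·d, with d that of D 1. Hence D = ad(B − d). -/
theorem inner_of_separable (hM : M.IsNonderogatory) (hs : (minpoly ℝ M).Separable)
    (D : LieDerivation ℝ (GLie M) (GLie M)) : ∃ x : GLie M, ∀ y : GLie M, D y = ⁅x, y⁆ := by
  let e : GLie M := ⟨0, 1, one_mem_polyLie⟩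
  let ι : (Fin n → ℝ) →ₗ⁅ℝ⁆ GLie M := LieAlgebra.SemiDirectSum.inl (matrixAction (polyLie M))
  have hleib (u w : GLie M) : D ⁅u, w⁆ = ⁅u, D w⁆ - ⁅w, D u⁆ := D.apply_lie_eq_sub u w
  have hr (x : Fin n → ℝ) : (D (ι x)).right = 0 := by
    have h1 : ι x = ⁅e, ι x⁆ := by
      rw [GLie_lie]
      apply GLie_ext <;> simp [ι, e]
    rw [h1, hleib, LieAlgebra.SemiDirectSum.sub_eq_mk]
    simp only [GLie_lie_right, sub_self]
  let B : Matrix (Fin n) (Fin n) ℝ := LinearMap.toMatrix'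
    ((LieAlgebra.SemiDirectSum.projl (matrixAction (polyLie M))).comp
      (D.toLinearMap.comp ι.toLinearMap))
  have hl (x : Fin n → ℝ) : (D (ι x)).left = B.mulVec x := by
    rw [← Matrix.toLin'_apply, Matrix.toLin'_toMatrix']
    rfl
  have hδ (a : polyLie M) :
      ((D ⟨0, a⟩).right : Matrix (Fin n) (Fin n) ℝ) = B * a.1 - a.1 * B := by
    apply Matrix.mulVec_injective
    funext x
    have h1 : ⁅(⟨0, a⟩ : GLie M), ι x⁆ = ι (a.1.mulVec x) := by
      rw [GLie_lie]
      apply GLie_ext <;> simp [ι]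
    have h2 := hleib ⟨0, a⟩ (ι x)
    rw [h1] at h2
    replace h2 := congrArg LieAlgebra.SemiDirectSum.left h2
    rw [LieAlgebra.SemiDirectSum.sub_eq_mk] at h2
    simp only [hl, GLie_lie_left, hr] at h2
    simp only [ι, LieAlgebra.SemiDirectSum.inl_eq_mk] at h2
    rw [Matrix.sub_mulVec, ← Matrix.mulVec_mulVec, ← Matrix.mulVec_mulVec, h2]
    simp
  have hMm : M ∈ polyLie M := by simpa using aeval_mem_polyLie (M := M) X
  have hBM : B * M = M * B := by
    apply commute_of_separable hs
    rw [← hδ ⟨M, hMm⟩]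
    exact polyLie_mul_comm hMm (D ⟨0, M, hMm⟩).right.2
  have hB : B ∈ polyLie M := hM.mem_polyLie_of_commute hBM
  have hν (a : polyLie M) : (D ⟨0, a⟩).left = a.1.mulVec (D e).left := by
    have h1 : ⁅e, (⟨0, a⟩ : GLie M)⁆ = 0 := by
      rw [GLie_lie]
      apply GLie_ext <;> simp [e]
    have h2 := hleib e ⟨0, a⟩
    rw [h1, map_zero] at h2
    replace h2 := congrArg LieAlgebra.SemiDirectSum.left h2
    rw [LieAlgebra.SemiDirectSum.sub_eq_mk] at h2
    simp only [GLie_lie_left] at h2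
    simp only [e, Matrix.one_mulVec, Matrix.mulVec_zero, sub_zero] at h2
    exact sub_eq_zero.1 h2.symm
  refine ⟨⟨-(D e).left, B, hB⟩, fun y => ?_⟩
  have hy : y = ι y.left + ⟨0, y.right⟩ := by
    apply GLie_ext <;> simp [ι]
  rw [GLie_lie]
  apply GLie_ext
  · rw [hy, map_add, LieAlgebra.SemiDirectSum.add_eq_mk, hl, hν]
    simp [ι, Matrix.mulVec_neg]
  · rw [hy, map_add, LieAlgebra.SemiDirectSum.add_eq_mk, hr, zero_add, hδ,
      polyLie_mul_comm hB y.right.2, sub_self]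
    rfl

theorem LieIdeal.coe_lie {L : Type*} [LieRing L] [LieAlgebra ℝ L] (I : LieIdeal ℝ L) (x y : I) :
    ((⁅x, y⁆ : I) : L) = ⁅(x : L), (y : L)⁆ := rfl

/-- In `𝒢_M` with `ℝ[M]` reduced, every nilpotent ideal is contained in `ℝⁿ`. -/
theorem right_eq_zero_of_mem_nilpotent (hs : (minpoly ℝ M).Separable) (I : LieIdeal ℝ (GLie M))
    (hI : LieRing.IsNilpotent I) {u : GLie M} (hu : u ∈ I) : u.right = 0 := by
  obtain ⟨k, hk⟩ := LieModule.isNilpotent_toEnd_of_isNilpotent ℝ I I ⟨u, hu⟩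
  apply Subtype.ext
  refine eq_zero_of_pow_eq_zero_of_separable hs u.right.2 (k := k + 1) ?_
  apply Matrix.mulVec_injective
  funext y
  -- The vector y need not lie in I, but [u, y] does; this costs one extra power, hence k + 1.
  have hy : (⟨u.right.1.mulVec y, 0⟩ : GLie M) ∈ I := by
    have h1 : ⁅u, (⟨y, 0⟩ : GLie M)⁆ ∈ I := by
      rw [← lie_skew]
      exact I.neg_mem (I.lie_mem hu)
    rw [GLie_lie] at h1
    simpa using h1
  have hpow (j : ℕ) : ((LieModule.toEnd ℝ I I ⟨u, hu⟩ ^ j) ⟨_, hy⟩ : GLie M) =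
      ⟨(u.right.1 ^ (j + 1)).mulVec y, 0⟩ := by
    induction j with
    | zero => simp
    | succ j ih =>
      rw [pow_succ', Module.End.mul_apply, LieModule.toEnd_apply_apply, LieIdeal.coe_lie, ih,
        GLie_lie, pow_succ' _ (j + 1)]
      simp
  have h2 := hpow k
  rw [hk] at h2
  simpa using (congrArg LieAlgebra.SemiDirectSum.left h2).symm

theorem nilradical_isLieAbelian_of_separable (hs : (minpoly ℝ M).Separable) :
    IsLieAbelian (lieNilradical (GLie M)) := by
  let p := LieAlgebra.SemiDirectSum.projr (matrixAction (polyLie M))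
  have hle : lieNilradical (GLie M) ≤ p.ker := by
    refine sSup_le fun I hI u hu => ?_
    rw [LieHom.mem_ker]
    exact right_eq_zero_of_mem_nilpotent hs I hI hu
  refine ⟨fun x y => Subtype.ext ?_⟩
  have hx : x.1.right = 0 := LieHom.mem_ker.1 (hle x.2)
  have hy : y.1.right = 0 := LieHom.mem_ker.1 (hle y.2)
  rw [LieIdeal.coe_lie, GLie_lie, hx, hy]
  simp

/-- For a² = 0, the ideal ℝa + ℝⁿ satisfies (ad u)² = 0 for each of its elements u, so it is
nilpotent by Engel. If the nilradical is Abelian, a kills ℝⁿ. -/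
theorem separable_of_nilradical_isLieAbelian (h : IsLieAbelian (lieNilradical (GLie M))) :
    (minpoly ℝ M).Separable := by
  by_contra hs
  obtain ⟨a, ha, ha0, haa⟩ := exists_mul_self_eq_zero_of_not_separable hs
  let I : LieIdeal ℝ (GLie M) :=
    { carrier := {u | ∃ c : ℝ, c • a = u.right}
      add_mem' := by
        rintro u w ⟨c, hc⟩ ⟨d, hd⟩
        exact ⟨c + d, by rw [add_smul, hc, hd]; rfl⟩
      zero_mem' := ⟨0, by rw [zero_smul]; rfl⟩
      smul_mem' := by
        rintro t u ⟨c, hc⟩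
        exact ⟨t * c, by rw [mul_smul, hc]; rfl⟩
      lie_mem := fun {u w} _ => ⟨0, by rw [GLie_lie_right, zero_smul]; rfl⟩ }
  have hsq (u w : GLie M) (c d : ℝ) (hc : c • a = u.right.1) (hd : d • a = w.right.1) :
      ⁅u, ⁅u, w⁆⁆ = 0 := by
    apply GLie_ext
    · rw [GLie_lie_left, GLie_lie_left, GLie_lie_right, ← hc, ← hd]
      simp [Matrix.mulVec_sub, Matrix.smul_mulVec, Matrix.mulVec_smul, haa]
    · rw [GLie_lie_right]
      rfl
  have hI : LieRing.IsNilpotent I := by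
    have : IsNoetherian ℝ I := isNoetherian_submodule' I.toSubmodule
    rw [LieAlgebra.isNilpotent_iff_forall (R := ℝ)]
    rintro ⟨u, c, hc⟩
    refine ⟨2, LinearMap.ext ?_⟩
    rintro ⟨w, d, hd⟩
    apply Subtype.ext
    rw [pow_two, Module.End.mul_apply, LieAlgebra.ad_apply, LieAlgebra.ad_apply,
      LieIdeal.coe_lie, LieIdeal.coe_lie]
    exact hsq u w c d hc hd
  have hle : I ≤ lieNilradical (GLie M) := le_sSup hI
  apply ha0
  apply Matrix.mulVec_injective
  funext y
  have h1 := h.trivial ⟨⟨0, a, ha⟩, hle ⟨1, one_smul _ _⟩⟩ ⟨⟨y, 0⟩, hle ⟨0, zero_smul _ _⟩⟩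
  replace h1 := congrArg (fun u => u.1.left) h1
  simp only [LieIdeal.coe_lie, GLie_lie_left] at h1
  simpa using h1

end

/-! ### Direct sums of affine algebras -/

section

open Polynomial

/-- The property of a Lie algebra that every `u` with `(ad u)² = 0` centralizes `[L, L]`. -/
def SqZeroCentralizesDerived (L : Type*) [LieRing L] : Prop :=
  ∀ u : L, (∀ w : L, ⁅u, ⁅u, w⁆⁆ = 0) → ∀ s t : L, ⁅u, ⁅s, t⁆⁆ = 0

/-- Testing (ad u)² on the translation 1 squares the linear part of u, which therefore vanishes;
translations commute with the derived algebra. -/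
theorem sqZeroCentralizesDerived_aff (K : Type) [Field K] [Algebra ℝ K] :
    SqZeroCentralizesDerived (Aff K) := by
  intro u hu s t
  have h := congrArg LieAlgebra.SemiDirectSum.left (hu ⟨1, 0⟩)
  simp only [Aff_lie] at h
  have h0 : u.right = 0 := by simpa using h
  simp only [Aff_lie]
  simp [h0]

theorem SqZeroCentralizesDerived.directSum {ι : Type*} [DecidableEq ι] {L : Type*} [LieRing L]
    (h : SqZeroCentralizesDerived L) :
    SqZeroCentralizesDerived (DirectSum ι fun _ => L) := by
  intro u hu s t
  ext i
  rw [DirectSum.bracket_apply, DirectSum.bracket_apply]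
  refine h (u i) (fun w => ?_) (s i) (t i)
  have := congrArg (fun f : DirectSum ι fun _ => L => f i) (hu (DirectSum.of (fun _ => L) i w))
  simpa [DirectSum.bracket_apply] using this

theorem SqZeroCentralizesDerived.prod {L₁ L₂ : Type*} [LieRing L₁] [LieRing L₂]
    (h₁ : SqZeroCentralizesDerived L₁) (h₂ : SqZeroCentralizesDerived L₂) :
    SqZeroCentralizesDerived (L₁ × L₂) := fun u hu s t => Prod.ext
  (h₁ u.1 (fun w => congrArg Prod.fst (hu (w, 0))) s.1 t.1)
  (h₂ u.2 (fun w => congrArg Prod.snd (hu (0, w))) s.2 t.2)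

theorem SqZeroCentralizesDerived.of_lieEquiv {L₁ L₂ : Type*} [LieRing L₁] [LieAlgebra ℝ L₁]
    [LieRing L₂] [LieAlgebra ℝ L₂] (e : L₁ ≃ₗ⁅ℝ⁆ L₂) (h : SqZeroCentralizesDerived L₂) :
    SqZeroCentralizesDerived L₁ := by
  intro u hu s t
  refine e.injective (?_ : e _ = e _)
  rw [LieEquiv.map_lie, LieEquiv.map_lie, map_zero]
  refine h (e u) (fun w => ?_) _ _
  have := congrArg e (hu (e.symm w))
  rwa [LieEquiv.map_lie, LieEquiv.map_lie, map_zero, LieEquiv.apply_symm_apply] at this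

/-- If a² = 0 then (ad a)² = 0, whereas [a, [1, y]] = ay. -/
theorem separable_of_sqZeroCentralizesDerived {n : ℕ} {M : Matrix (Fin n) (Fin n) ℝ}
    (h : SqZeroCentralizesDerived (GLie M)) : (minpoly ℝ M).Separable := by
  by_contra hs
  obtain ⟨a, ha, ha0, haa⟩ := exists_mul_self_eq_zero_of_not_separable hs
  apply ha0
  apply Matrix.mulVec_injective
  funext y
  have h1 := h ⟨0, a, ha⟩ (fun w => by
    rw [GLie_lie, GLie_lie]
    apply GLie_ext <;> simp [haa]) ⟨0, 1, one_mem_polyLie⟩ ⟨y, 0⟩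
  rw [GLie_lie, GLie_lie] at h1
  simpa using congrArg LieAlgebra.SemiDirectSum.left h1

/-- A finite reduced commutative real algebra is a product of copies of `ℝ` and `ℂ`. -/
theorem exists_algEquiv_pi_real_prod_pi_complex (R : Type*) [CommRing R] [Algebra ℝ R]
    [Module.Finite ℝ R] [IsReduced R] :
    ∃ p q : ℕ, Nonempty (R ≃ₐ[ℝ] (Fin p → ℝ) × (Fin q → ℂ)) := by
  classical
  have : IsArtinianRing R := IsArtinianRing.of_finite ℝ R
  have hK (I : MaximalSpectrum R) : Nonempty ((R ⧸ I.asIdeal) ≃ₐ[ℝ] ℝ) ∨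
      Nonempty ((R ⧸ I.asIdeal) ≃ₐ[ℝ] ℂ) := by
    let _ : Field (R ⧸ I.asIdeal) := Ideal.Quotient.field I.asIdeal
    exact Real.nonempty_algEquiv_or _
  let P (I : MaximalSpectrum R) : Prop := Nonempty ((R ⧸ I.asIdeal) ≃ₐ[ℝ] ℝ)
  have : Finite (MaximalSpectrum R) := inferInstance
  let s := (Finite.equivFin {I // P I}).symm
  let t := (Finite.equivFin {I // ¬ P I}).symm
  let f (i) : (R ⧸ (s i).1.asIdeal) ≃ₐ[ℝ] ℝ := (s i).2.some
  let g (j) : (R ⧸ (t j).1.asIdeal) ≃ₐ[ℝ] ℂ := ((hK (t j).1).resolve_left (t j).2).some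
  let Φ : R →ₐ[ℝ] (Fin _ → ℝ) × (Fin _ → ℂ) :=
    (AlgHom.pi fun i => (f i).toAlgHom.comp (Ideal.Quotient.mkₐ ℝ _)).prod
      (AlgHom.pi fun j => (g j).toAlgHom.comp (Ideal.Quotient.mkₐ ℝ _))
  have h1 (x : R) (i) : (Φ x).1 i = f i (Ideal.Quotient.mk _ x) := rfl
  have h2 (x : R) (j) : (Φ x).2 j = g j (Ideal.Quotient.mk _ x) := rfl
  refine ⟨_, _, ⟨AlgEquiv.ofBijective Φ ⟨?_, ?_⟩⟩⟩
  · rw [injective_iff_map_eq_zero]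
    intro x hx
    apply (IsArtinianRing.equivPi R).injective
    rw [map_zero]
    funext I
    rw [IsArtinianRing.equivPi_apply]
    by_cases hI : P I
    · have := h1 x (s.symm ⟨I, hI⟩)
      rw [hx] at this
      have := (map_eq_zero_iff _ (f _).injective).1 this.symm
      rwa [s.apply_symm_apply] at this
    · have := h2 x (t.symm ⟨I, hI⟩)
      rw [hx] at this
      have := (map_eq_zero_iff _ (g _).injective).1 this.symm
      rwa [t.apply_symm_apply] at this
  · rintro ⟨y, z⟩
    -- The Chinese remainder preimage needs a family indexed by maximal ideals, so values are
    -- transported along the enumerations s and t.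
    let w₁ (I : {I // P I}) : R ⧸ I.1.asIdeal :=
      s.apply_symm_apply I ▸ (f (s.symm I)).symm (y (s.symm I))
    let w₂ (I : {I // ¬ P I}) : R ⧸ I.1.asIdeal :=
      t.apply_symm_apply I ▸ (g (t.symm I)).symm (z (t.symm I))
    have hw₁ (i) : w₁ (s i) = (f i).symm (y i) := by
      have (j) (h : s j = s i) : h ▸ (f j).symm (y j) = (f i).symm (y i) := by
        obtain rfl := s.injective h
        rfl
      exact this _ _
    have hw₂ (i) : w₂ (t i) = (g i).symm (z i) := by
      have (j) (h : t j = t i) : h ▸ (g j).symm (z j) = (g i).symm (z i) := by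
        obtain rfl := t.injective h
        rfl
      exact this _ _
    let w (I : MaximalSpectrum R) : R ⧸ I.asIdeal :=
      if h : P I then w₁ ⟨I, h⟩ else w₂ ⟨I, h⟩
    have hw (I) : Ideal.Quotient.mk I.asIdeal ((IsArtinianRing.equivPi R).symm w) = w I := by
      conv_rhs => rw [← (IsArtinianRing.equivPi R).apply_symm_apply w]
      rfl
    refine ⟨(IsArtinianRing.equivPi R).symm w, Prod.ext (funext fun i => ?_) (funext fun j => ?_)⟩
    · rw [h1, hw, show w (s i).1 = w₁ (s i) from dif_pos (s i).2, hw₁, AlgEquiv.apply_symm_apply]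
    · rw [h2, hw, show w (t j).1 = w₂ (t j) from dif_neg (t j).2, hw₂, AlgEquiv.apply_symm_apply]

theorem LinearMap.exists_equiv_of_ker_eq {R N U W : Type*} [Ring R] [AddCommGroup N] [Module R N]
    [AddCommGroup U] [Module R U] [AddCommGroup W] [Module R W] (f : N →ₗ[R] U) (g : N →ₗ[R] W)
    (hf : Function.Surjective f) (hg : Function.Surjective g)
    (h : LinearMap.ker f = LinearMap.ker g) : ∃ e : U ≃ₗ[R] W, ∀ x, e (f x) = g x := by
  refine ⟨(f.quotKerEquivOfSurjective hf).symm.trans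
    ((Submodule.quotEquivOfEq _ _ h).trans (g.quotKerEquivOfSurjective hg)), fun x => ?_⟩
  have : (f.quotKerEquivOfSurjective hf).symm (f x) = Submodule.Quotient.mk x := by
    rw [LinearEquiv.symm_apply_eq]
    rfl
  rw [LinearEquiv.trans_apply, this]
  rfl

/-- ℝ[M], ℝⁿ and ℝᵖ × ℂ^q are quotients of ℝ[X] by the same kernel (m). The induced isomorphisms
`EA` and `EV` turn the action into componentwise multiplication, so the bracket splits by factors.
-/
theorem exists_lieEquiv_of_separable {n : ℕ} {M : Matrix (Fin n) (Fin n) ℝ}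
    (hM : M.IsNonderogatory) (hs : (minpoly ℝ M).Separable) :
    ∃ p q : ℕ, Nonempty (GLie M ≃ₗ⁅ℝ⁆
      (DirectSum (Fin p) (fun _ => Aff ℝ) × DirectSum (Fin q) (fun _ => Aff ℂ))) := by
  obtain ⟨v, hv, hsurj⟩ := hM.exists_cyclic
  have hred : IsReduced (AdjoinRoot (minpoly ℝ M)) :=
    (Ideal.isRadical_iff_quotient_reduced _).1
      (isRadical_iff_span_singleton.1 hs.squarefree.isRadical)
  have hfin : Module.Finite ℝ (AdjoinRoot (minpoly ℝ M)) :=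
    (minpoly.monic (Algebra.IsIntegral.isIntegral M)).finite_adjoinRoot
  obtain ⟨p, q, ⟨θ⟩⟩ := exists_algEquiv_pi_real_prod_pi_complex (AdjoinRoot (minpoly ℝ M))
  let Φ : ℝ[X] →ₐ[ℝ] (Fin p → ℝ) × (Fin q → ℂ) := θ.toAlgHom.comp (AdjoinRoot.mkₐ (minpoly ℝ M))
  have hΦs : Function.Surjective Φ := θ.surjective.comp AdjoinRoot.mk_surjective
  have hΦ (f : ℝ[X]) : Φ f = 0 ↔ aeval M f = 0 := by
    rw [← minpoly.dvd_iff, ← AdjoinRoot.mk_eq_zero]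
    exact map_eq_zero_iff θ θ.injective
  let F : ℝ[X] →ₗ[ℝ] polyLie M := (aeval M).toLinearMap.codRestrict (polyLie M).toSubmodule
    aeval_mem_polyLie
  let G : ℝ[X] →ₗ[ℝ] (Fin n → ℝ) :=
    ((Matrix.mulVecBilin ℝ ℝ).flip v).comp (aeval M).toLinearMap
  obtain ⟨EA, hEA⟩ := LinearMap.exists_equiv_of_ker_eq F Φ.toLinearMap
    (fun a => by obtain ⟨f, hf⟩ := mem_polyLie.1 a.2; exact ⟨f, Subtype.ext hf⟩) hΦs
    (by ext f; exact Subtype.ext_iff.trans (hΦ f).symm)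
  obtain ⟨EV, hEV⟩ := LinearMap.exists_equiv_of_ker_eq G Φ.toLinearMap hsurj hΦs
    (by
      ext f
      refine Iff.trans ⟨hv f, fun h => ?_⟩ (hΦ f).symm
      change (aeval M f).mulVec v = 0
      rw [h, Matrix.zero_mulVec])
  have hmul (a : polyLie M) (x : Fin n → ℝ) : EV (a.1.mulVec x) = EA a * EV x := by
    obtain ⟨f, hf⟩ := mem_polyLie.1 a.2
    obtain rfl : F f = a := Subtype.ext hf
    obtain ⟨g, rfl⟩ := hsurj x
    have h1 : (F f).1.mulVec ((aeval M g).mulVec v) = G (f * g) := by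
      rw [Matrix.mulVec_mulVec, show (F f).1 = aeval M f from rfl, ← map_mul]
      rfl
    rw [h1, hEA, hEV, show (aeval M g).mulVec v = G g from rfl, hEV]
    exact map_mul Φ f g
  let T₁ : ((Fin n → ℝ) × polyLie M) ≃ₗ[ℝ] (Fin p → Aff ℝ) × (Fin q → Aff ℂ) :=
    (EV.prodCongr EA).trans
      { toFun := fun u => (fun i => ⟨u.1.1 i, u.2.1 i⟩, fun j => ⟨u.1.2 j, u.2.2 j⟩)
        invFun := fun u => ((fun i => (u.1 i).left, fun j => (u.2 j).left),
          (fun i => (u.1 i).right, fun j => (u.2 j).right))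
        map_add' := fun _ _ => rfl
        map_smul' := fun _ _ => rfl
        left_inv := fun _ => rfl
        right_inv := fun _ => rfl }
  let T : GLie M ≃ₗ[ℝ] DirectSum (Fin p) (fun _ => Aff ℝ) × DirectSum (Fin q) (fun _ => Aff ℂ) :=
    (LieAlgebra.SemiDirectSum.toProdl (matrixAction (polyLie M))).trans
      (T₁.trans ((DirectSum.linearEquivFunOnFintype ℝ (Fin p) fun _ => Aff ℝ).symm.prodCongr
        (DirectSum.linearEquivFunOnFintype ℝ (Fin q) fun _ => Aff ℂ).symm))
  have hT₁ (u : GLie M) (i : Fin p) : (T u).1 i = ⟨(EV u.left).1 i, (EA u.right).1 i⟩ := rfl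
  have hT₂ (u : GLie M) (j : Fin q) : (T u).2 j = ⟨(EV u.left).2 j, (EA u.right).2 j⟩ := rfl
  refine ⟨p, q, ⟨{ T with map_lie' := fun {u w} => ?_ }⟩⟩
  change T ⁅u, w⁆ = ⁅T u, T w⁆
  rw [LieAlgebra.Prod.bracket_apply]
  refine Prod.ext (DFinsupp.ext fun i => ?_) (DFinsupp.ext fun j => ?_)
  · change (T ⁅u, w⁆).1 i = ⁅(T u).1, (T w).1⁆ i
    rw [DirectSum.bracket_apply, hT₁, hT₁, hT₁, Aff_lie, GLie_lie, map_sub, hmul, hmul, map_zero]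
    rfl
  · change (T ⁅u, w⁆).2 j = ⁅(T u).2, (T w).2⁆ j
    rw [DirectSum.bracket_apply, hT₂, hT₂, hT₂, Aff_lie, GLie_lie, map_sub, hmul, hmul, map_zero]
    rfl

end

theorem mainTheorem8 (n : ℕ) (M : Matrix (Fin n) (Fin n) ℝ) (hM : M.IsNonderogatory) :
    List.TFAE
      [ ∀ D : LieDerivation ℝ (GLie M) (GLie M), ∃ x : GLie M, ∀ y : GLie M, D y = ⁅x, y⁆,
        (polyLie M).IsCartanSubalgebra,
        {z : ℂ | Module.End.HasEigenvalue
          (Matrix.toLin' (M.map (algebraMap ℝ ℂ))) z}.ncard = n,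
        IsLieAbelian (lieNilradical (GLie M)),
        ∃ p q : ℕ, Nonempty (GLie M ≃ₗ⁅ℝ⁆
          (DirectSum (Fin p) (fun _ => Aff ℝ) × DirectSum (Fin q) (fun _ => Aff ℂ))) ] := by
  rw [ncard_eigenvalues_eq_iff hM]
  tfae_have 1 → 2 := polyLie_isCartanSubalgebra_of_forall_inner hM
  tfae_have 2 → 3 := separable_of_polyLie_isCartanSubalgebra hM
  tfae_have 3 → 1 := inner_of_separable hM
  tfae_have 3 → 4 := nilradical_isLieAbelian_of_separable
  tfae_have 4 → 3 := separable_of_nilradical_isLieAbelian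
  tfae_have 3 → 5 := exists_lieEquiv_of_separable hM
  tfae_have 5 → 3 := fun ⟨_, _, ⟨e⟩⟩ => separable_of_sqZeroCentralizesDerived <|
    .of_lieEquiv e <| .prod (.directSum (sqZeroCentralizesDerived_aff ℝ))
      (.directSum (sqZeroCentralizesDerived_aff ℂ))
  tfae_finish
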